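/- Let $X\subseteq A^{\mathbb Z}$ and $Y\subseteq B^{\mathbb Z}$ be two-sided shift spaces over finite alphabets, each with its left shift map $\sigma$. Suppose that $X$ is an irreducible sofic shift and let $\pi:X\to Y$ be a finite-to-one factor code, that is, a continuous shift-commuting surjection all of whose fibers are finite. Let $d_\pi$ be the degree of $\pi$: the number such that every doubly transitive point $y\in Y$ (every block of $Y$ occurs in $y$ infinitely often to the left and to the right) has exactly $d_\pi$ preimages under $\pi$. That such a number exists, and is positive, is part of the assertion. Let $\nu$ be a fully supported ergodic shift-invariant Borel probability measure on $Y$. Then there exists a degree joining over $\nu$ with respect to $\pi$, that is, an ergodic $d_\pi$-fold separating relative joining over $\nu$: a Borel probability measure $\lambda$ on $X^{d_\pi}$ which is invariant and ergodic under the diagonal map $\sigma\times\cdots\times\sigma$ and satisfies 1. for $\lambda$-a.e. $(x^{(1)},\dots,x^{(d_\pi)})$, $\pi(x^{(1)})=\cdots=\pi(x^{(d_\pi)})$; 2. $\pi_*(p_i)_*\lambda=\nu$ for some (hence for every) $i$, where $p_i:X^{d_\pi}\to X$ is the projection to the $i$-th coordinate; 3. for $\lambda$-a.e. $(x^{(1)},\dots,x^{(d_\pi)})$,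 the points $x^{(1)},\dots,x^{(d_\pi)}$ are pairwise distinct. -/

import Mathlib

namespace SoficCode

open MeasureTheory SymbolicDynamics.FullShift

/-- The left shift `(σ x) i = x (i + 1)` on a two-sided shift space. -/
def shiftMap {A : Type*} [TopologicalSpace A] (X : Subshift A ℤ) : X.carrier → X.carrier :=
  (X.mapsTo 1).restrict (shift (1 : ℤ)) X.carrier X.carrier

/-- The word `u` occurs in the bi-infinite sequence `x` starting at coordinate `i`. -/
def OccursAt {A : Type*} (u : List A) (x : ℤ → A) (i : ℤ) : Prop :=
  ∀ (k : ℕ) (hk : k < u.length), x (i + k) = u[k]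

/-- The language of a shift space: the words (blocks) occurring in its points. -/
def language {A : Type*} [TopologicalSpace A] (X : Subshift A ℤ) : Set (List A) :=
  {u | ∃ x ∈ X.carrier, ∃ i : ℤ, OccursAt u x i}

/-- A shift space is irreducible if any two of its blocks `u`, `v` can be joined by a word `w`
to a block `u w v`. -/
def IsIrreducible {A : Type*} [TopologicalSpace A] (X : Subshift A ℤ) : Prop :=
  ∀ u ∈ language X, ∀ v ∈ language X, ∃ w : List A, u ++ w ++ v ∈ language X

/-- A shift of finite type: a shift space defined by finitely many forbidden patterns. -/
def IsSFT {A : Type*} [TopologicalSpace A] [Inhabited A] (X : Subshift A ℤ) : Prop :=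
  ∃ F : Set (Pattern A ℤ), F.Finite ∧ X.carrier = forbidden F

/-- A factor code (factor map between shift spaces): continuous, shift-commuting, onto. -/
structure IsFactorCode {A B : Type*} [TopologicalSpace A] [TopologicalSpace B]
    {X : Subshift A ℤ} {Y : Subshift B ℤ} (π : X.carrier → Y.carrier) : Prop where
  continuous : Continuous π
  semiconj : Function.Semiconj π (shiftMap X) (shiftMap Y)
  surjective : Function.Surjective π

/-- A sofic shift: the image of a shift of finite type (over a finite alphabet) under a
factor code. -/
def IsSofic {A : Type*} [TopologicalSpace A] (X : Subshift A ℤ) : Prop :=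
  ∃ (k : ℕ) (Z : Subshift (Fin (k + 1)) ℤ) (ρ : Z.carrier → X.carrier),
    IsSFT Z ∧ IsFactorCode ρ

/-- All fibers are finite. -/
def IsFiniteToOne {α β : Type*} (π : α → β) : Prop :=
  ∀ y : β, (π ⁻¹' {y}).Finite

/-- A point of a shift space is doubly transitive if every block of the shift space occurs in it
infinitely often to the left and infinitely often to the right. -/
def IsDoublyTransitive {A : Type*} [TopologicalSpace A] {X : Subshift A ℤ} (x : X.carrier) :
    Prop :=
  ∀ u ∈ language X, ∀ N : ℤ,
    (∃ i ≥ N, OccursAt u (x : ℤ → A) i) ∧ (∃ i ≤ N, OccursAt u (x : ℤ → A) i)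

/-- Every doubly transitive point of `Y` has exactly `d` preimages under `π`. -/
def IsDegree {A B : Type*} [TopologicalSpace A] [TopologicalSpace B]
    {X : Subshift A ℤ} {Y : Subshift B ℤ} (π : X.carrier → Y.carrier) (d : ℕ) : Prop :=
  ∀ y : Y.carrier, IsDoublyTransitive y → (π ⁻¹' {y}).encard = d

open Classical in
/-- The degree of `π`: the number `d` such that every doubly transitive point of `Y` has exactly
`d` preimages (and `0` if there is no such number, in which case no joining of that many points
lies over a measure). -/
noncomputable def degree {A B : Type*} [TopologicalSpace A] [TopologicalSpace B]
    {X : Subshift A ℤ} {Y : Subshift B ℤ} (π : X.carrier → Y.carrier) : ℕ :=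
  if h : ∃ d : ℕ, IsDegree π d then h.choose else 0

/-- The diagonal action `T × ⋯ × T` on `n`-tuples. -/
def diagMap {α : Type*} (T : α → α) (n : ℕ) : (Fin n → α) → (Fin n → α) :=
  fun p i => T (p i)

/-- An `n`-fold `π`-relative joining: an invariant probability measure on `n`-tuples for which
almost every tuple lies in a single fiber of `π`. -/
structure IsRelativeJoining {α β : Type*} [MeasurableSpace α] (T : α → α) (π : α → β)
    {n : ℕ} (lam : Measure (Fin n → α)) : Prop where
  isProbabilityMeasure : IsProbabilityMeasure lam
  invariant : MeasurePreserving (diagMap T n) lam lam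
  ae_fiber : ∀ᵐ p ∂lam, ∀ i j : Fin n, π (p i) = π (p j)

/-- The joining lies over `ν`: the image under `π` of one (hence each) of its margins is `ν`. -/
def LiesOver {α β : Type*} [MeasurableSpace α] [MeasurableSpace β] (π : α → β)
    {n : ℕ} (lam : Measure (Fin n → α)) (ν : Measure β) : Prop :=
  ∃ i : Fin n, (lam.map (fun p => p i)).map π = ν

/-- The joining is separating: almost every tuple consists of `n` distinct points. -/
def IsSeparating {α : Type*} [MeasurableSpace α] {n : ℕ} (lam : Measure (Fin n → α)) : Prop :=
  ∀ᵐ p ∂lam, Function.Injective p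

end SoficCode

/-!
The degree of `π` exists because preimages can be transplanted from one doubly transitive point to
another. Write `X` as the image `ρ Z` of a shift of finite type. For `y` in `Y`, consider the set
of blocks of a fixed large radius that the points of `Z` over `y` show around a coordinate `t`.
This set is upper semicontinuous in `y`, so if it has the least possible size at some `y₀`, then by
compactness it is determined by a block of `y₀`, a magic block, wherever that block occurs
(`exists_magic_block`). Let `y` and `y'` be doubly transitive. The finitely many preimages of `y`
differ between two occurrences `t₁ < t₂` of the magic block, and `y'` has a translate that agrees
with `y` around `[t₁, t₂]`. A point of `Z` over `y` then agrees around `t₁` with one point over the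
translate, and around `t₂` with another, so that the three can be spliced into a point over the
translate that looks over `[t₁, t₂]` like the given one. Hence `y'` has at least as many preimages
as `y` (`encard_fiber_le_of_isDoublyTransitive`).

By ergodicity and full support, `ν`-almost every point is doubly transitive
(`ae_isDoublyTransitive`), so that almost every fiber of `π` has exactly `d` points, where `d` is
the degree. The Lusin–Souslin theorem gives a measurable enumeration `s y` of these fibers
(`exists_measurable_enumeration`). The measure that sums over all orderings of `s y` and integrates
over `ν` is invariant under the diagonal map, since that map carries the enumerations of one fiber
bijectively onto those of the next, and it is a separating relative joining over `ν` after
normalisation. For an invariant set `W` of tuples, the number of orderings of `s y` in `W` is an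
invariant function of `y`, hence almost everywhere equal to a natural number. No general ergodic
decomposition is needed: the restriction to an invariant set for which this number is positive and
minimal is ergodic, and it still projects to a multiple of `ν`
(`exists_ergodic_separating_joining`).
-/

namespace SoficCode

open MeasureTheory SymbolicDynamics.FullShift Set

/-! ### Translations and windows -/

/-- Translation by `t : ℤ` on a shift space, `(translate X t x) j = x (t + j)`. -/
def translate {A : Type*} [TopologicalSpace A] (X : Subshift A ℤ) (t : ℤ) :
    X.carrier → X.carrier :=
  (X.mapsTo t).restrict (shift t) X.carrier X.carrier

/-- The block of `x` on the coordinates `t - M, …, t + M`. -/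
def window {A : Type*} (M : ℕ) (t : ℤ) (x : ℤ → A) : Icc (-M : ℤ) M → A := fun j => x (t + j)

lemma window_eq_iff {A : Type*} {M : ℕ} {t : ℤ} {x x' : ℤ → A} :
    window M t x = window M t x' ↔ ∀ j : ℤ, |j| ≤ M → x (t + j) = x' (t + j) := by
  simp [window, funext_iff, abs_le]

section Windows

variable {A B : Type*} [TopologicalSpace A] [TopologicalSpace B]
  {X : Subshift A ℤ} {Y : Subshift B ℤ}

@[simp]
lemma translate_apply (t : ℤ) (x : X.carrier) (j : ℤ) :
    (translate X t x : ℤ → A) j = (x : ℤ → A) (t + j) := rfl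

lemma translate_translate (s t : ℤ) (x : X.carrier) :
    translate X s (translate X t x) = translate X (t + s) x := by
  ext j
  simp [add_assoc]

lemma translate_zero (x : X.carrier) : translate X 0 x = x := by
  ext j
  simp

lemma translate_one (x : X.carrier) : translate X 1 x = shiftMap X x := rfl

lemma semiconj_translate {π : X.carrier → Y.carrier}
    (h : Function.Semiconj π (shiftMap X) (shiftMap Y)) (t : ℤ) :
    Function.Semiconj π (translate X t) (translate Y t) := by
  have nat (n : ℕ) (x : X.carrier) : π (translate X n x) = translate Y n (π x) := by
    induction n generalizing x with
    | zero => simp [translate_zero]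
    | succ n ih =>
      have hx : translate X ((n + 1 : ℕ) : ℤ) x = shiftMap X (translate X n x) := by
        rw [← translate_one, translate_translate]; push_cast; rfl
      have hy : translate Y ((n + 1 : ℕ) : ℤ) (π x) = shiftMap Y (translate Y n (π x)) := by
        rw [← translate_one, translate_translate]; push_cast; rfl
      rw [hx, hy, h.eq, ih]
  intro x
  obtain ⟨n, rfl | rfl⟩ := t.eq_nat_or_neg
  · exact nat n x
  · have := nat n (translate X (-n) x)
    rw [translate_translate, neg_add_cancel, translate_zero] at this
    rw [this, translate_translate, add_neg_cancel, translate_zero]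

lemma continuous_coord (j : ℤ) : Continuous fun x : X.carrier => (x : ℤ → A) j :=
  (continuous_apply j).comp continuous_subtype_val

instance compactSpace_carrier [Finite A] : CompactSpace X.carrier :=
  isCompact_iff_compactSpace.mp X.isClosed.isCompact

/-- A continuous map from a shift space over a finite alphabet to a discrete space depends on
finitely many coordinates. -/
lemma exists_radius_of_continuous [Finite A] [DiscreteTopology A] {C : Type*}
    [TopologicalSpace C] [DiscreteTopology C] {f : X.carrier → C} (hf : Continuous f) :
    ∃ r : ℕ, ∀ x x' : X.carrier, (∀ j : ℤ, |j| ≤ r → (x : ℤ → A) j = (x' : ℤ → A) j) →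
      f x = f x' := by
  by_contra! hcon
  let K : ℕ → Set (X.carrier × X.carrier) := fun r =>
    {p | (∀ j : ℤ, |j| ≤ r → (p.1 : ℤ → A) j = (p.2 : ℤ → A) j) ∧ f p.1 ≠ f p.2}
  have hclosed (r : ℕ) : IsClosed (K r) := by
    have h1 : IsClosed {p : X.carrier × X.carrier |
        ∀ j : ℤ, |j| ≤ r → (p.1 : ℤ → A) j = (p.2 : ℤ → A) j} := by
      simp only [ofPred_forall]
      exact isClosed_iInter fun j => isClosed_iInter fun _ =>
        isClosed_eq ((continuous_coord j).comp continuous_fst)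
          ((continuous_coord j).comp continuous_snd)
    have h2 : IsClosed {p : X.carrier × X.carrier | f p.1 ≠ f p.2} :=
      (isClosed_discrete {c : C × C | c.1 ≠ c.2}).preimage
        ((hf.comp continuous_fst).prodMk (hf.comp continuous_snd))
    exact h1.inter h2
  obtain ⟨p, hp⟩ := IsCompact.nonempty_iInter_of_sequence_nonempty_isCompact_isClosed K
    (fun r p hp => ⟨fun j hj => hp.1 j (hj.trans (by push_cast; omega)), hp.2⟩)
    (fun r => by obtain ⟨x, x', h, hne⟩ := hcon r; exact ⟨(x, x'), h, hne⟩)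
    (hclosed 0).isCompact hclosed
  rw [mem_iInter] at hp
  refine (hp 0).2 (congrArg f (Subtype.ext (funext fun j => ?_)))
  exact (hp j.natAbs).1 j (by simp)

/-- The Curtis–Hedlund–Lyndon theorem: a continuous shift-commuting map between shift spaces is
a sliding block code. -/
lemma exists_radius_of_semiconj [Finite A] [DiscreteTopology A] [DiscreteTopology B]
    {π : X.carrier → Y.carrier} (hc : Continuous π)
    (hs : Function.Semiconj π (shiftMap X) (shiftMap Y)) :
    ∃ r : ℕ, ∀ (x x' : X.carrier) (t : ℤ),
      (∀ j : ℤ, |j| ≤ r → (x : ℤ → A) (t + j) = (x' : ℤ → A) (t + j)) →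
      (π x : ℤ → B) t = (π x' : ℤ → B) t := by
  obtain ⟨r, hr⟩ := exists_radius_of_continuous ((continuous_coord (0 : ℤ)).comp hc)
  refine ⟨r, fun x x' t h => ?_⟩
  have := hr (translate X t x) (translate X t x') h
  simpa [(semiconj_translate hs t).eq] using this

/-- In a shift of finite type, the left half of one point can be continued by the right half of
another, provided the two agree on a long enough block around the cut. -/
lemma IsSFT.exists_splice [Inhabited A] (hX : IsSFT X) :
    ∃ M₀ : ℕ, ∀ M ≥ M₀, ∀ (x x' : X.carrier) (t : ℤ), window M t (x : ℤ → A) = window M t x' →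
      ∃ z : X.carrier, (∀ j ≤ t + M, (z : ℤ → A) j = (x : ℤ → A) j) ∧
        ∀ j ≥ t - M, (z : ℤ → A) j = (x' : ℤ → A) j := by
  obtain ⟨F, hF, hXF⟩ := hX
  obtain ⟨M₀, hM₀⟩ : ∃ M₀ : ℕ, ∀ p ∈ F, ∀ h ∈ p.support, |h| ≤ (M₀ : ℤ) := by
    have hfin : (⋃ p ∈ F, (fun h : ℤ => h.natAbs) '' (p.support : Set ℤ)).Finite :=
      hF.biUnion fun p _ => p.support.finite_toSet.image _
    obtain ⟨M₀, hM₀⟩ := hfin.bddAbove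
    refine ⟨M₀, fun p hp h hh => ?_⟩
    have : h.natAbs ≤ M₀ := hM₀ (mem_biUnion hp (mem_image_of_mem _ hh))
    rw [Int.abs_eq_natAbs]
    exact_mod_cast this
  refine ⟨M₀, fun M hM x x' t hw => ?_⟩
  rw [window_eq_iff] at hw
  have hov (j : ℤ) (h1 : t - M ≤ j) (h2 : j ≤ t + M) : (x : ℤ → A) j = (x' : ℤ → A) j := by
    have := hw (j - t) (abs_le.2 ⟨by omega, by omega⟩)
    simpa using this
  let z : ℤ → A := fun j => if j ≤ t then (x : ℤ → A) j else (x' : ℤ → A) j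
  have hl (j : ℤ) (hj : j ≤ t + M) : z j = (x : ℤ → A) j := by
    by_cases h : j ≤ t
    · simp [z, h]
    · simp [z, h, hov j (by omega) hj]
  have hr (j : ℤ) (hj : t - M ≤ j) : z j = (x' : ℤ → A) j := by
    by_cases h : j ≤ t
    · simp [z, h, hov j hj (by omega)]
    · simp [z, h]
  refine ⟨⟨z, ?_⟩, hl, hr⟩
  have hx := hXF.subset x.2
  have hx' := hXF.subset x'.2
  rw [hXF]
  intro p hp g hocc
  -- A forbidden pattern based at `g` lies entirely where `z` agrees with one of the two points.
  by_cases hg : g ≤ t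
  · refine hx p hp g fun h hh => ?_
    have := abs_le.1 (hM₀ p hp h hh)
    rw [← hocc h hh, hl _ (by omega)]
  · refine hx' p hp g fun h hh => ?_
    have := abs_le.1 (hM₀ p hp h hh)
    rw [← hocc h hh, hr _ (by omega)]

end Windows

/-! ### The degree of a factor code -/

section Degree

variable {A B C : Type*} [TopologicalSpace A] [TopologicalSpace B] [TopologicalSpace C]
  {X : Subshift A ℤ} {Y : Subshift B ℤ} {Z : Subshift C ℤ}

/-- The blocks of radius `M` around the coordinate `t` that are seen in the preimages of `y`. -/
def fiberWindows (φ : Z.carrier → Y.carrier) (M : ℕ) (t : ℤ) (y : Y.carrier) :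
    Set (Icc (-M : ℤ) M → C) :=
  (fun z : Z.carrier => window M t (z : ℤ → C)) '' (φ ⁻¹' {y})

lemma fiberWindows_translate {φ : Z.carrier → Y.carrier}
    (hs : Function.Semiconj φ (shiftMap Z) (shiftMap Y)) (M : ℕ) (t : ℤ) (y : Y.carrier) :
    fiberWindows φ M 0 (translate Y t y) = fiberWindows φ M t y := by
  apply Subset.antisymm
  · rintro _ ⟨z, hz, rfl⟩
    refine ⟨translate Z (-t) z, ?_, ?_⟩
    · rw [mem_preimage, mem_singleton_iff] at hz ⊢
      rw [(semiconj_translate hs (-t)).eq, hz, translate_translate, add_neg_cancel,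
        translate_zero]
    · ext j
      simp [window]
  · rintro _ ⟨z, hz, rfl⟩
    refine ⟨translate Z t z, ?_, ?_⟩
    · rw [mem_preimage, mem_singleton_iff] at hz ⊢
      rw [(semiconj_translate hs t).eq, hz]
    · ext j
      simp [window]

/-- The set of blocks seen over `y` is upper semicontinuous in `y`. -/
lemma exists_radius_fiberWindows_subset [Finite C] [DiscreteTopology C] [DiscreteTopology B]
    {φ : Z.carrier → Y.carrier} (hc : Continuous φ) (M : ℕ) (y : Y.carrier) :
    ∃ n : ℕ, ∀ y' : Y.carrier, (∀ j : ℤ, |j| ≤ n → (y' : ℤ → B) j = (y : ℤ → B) j) →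
      fiberWindows φ M 0 y' ⊆ fiberWindows φ M 0 y := by
  by_contra! hcon
  let K : ℕ → Set Z.carrier := fun n =>
    {z | (∀ j : ℤ, |j| ≤ n → (φ z : ℤ → B) j = (y : ℤ → B) j) ∧
      window M 0 (z : ℤ → C) ∉ fiberWindows φ M 0 y}
  have hclosed (n : ℕ) : IsClosed (K n) := by
    have h1 : IsClosed {z : Z.carrier | ∀ j : ℤ, |j| ≤ n → (φ z : ℤ → B) j = (y : ℤ → B) j} := by
      simp only [ofPred_forall]
      exact isClosed_iInter fun j => isClosed_iInter fun _ =>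
        isClosed_eq ((continuous_coord j).comp hc) continuous_const
    have hw : Continuous fun z : Z.carrier => window M 0 (z : ℤ → C) :=
      continuous_pi fun j => continuous_coord _
    exact h1.inter ((isClosed_discrete (fiberWindows φ M 0 y)ᶜ).preimage hw)
  obtain ⟨z, hz⟩ := IsCompact.nonempty_iInter_of_sequence_nonempty_isCompact_isClosed K
    (fun r p hp => ⟨fun j hj => hp.1 j (hj.trans (by push_cast; omega)), hp.2⟩)
    (fun n => by
      obtain ⟨y', h, hne⟩ := hcon n
      obtain ⟨_, ⟨z, hz, rfl⟩, hw⟩ := not_subset.1 hne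
      rw [mem_preimage, mem_singleton_iff] at hz
      exact ⟨z, by rwa [hz], hw⟩)
    (hclosed 0).isCompact hclosed
  rw [mem_iInter] at hz
  refine (hz 0).2 ⟨z, ?_, rfl⟩
  rw [mem_preimage, mem_singleton_iff]
  exact Subtype.ext (funext fun j => (hz j.natAbs).1 j (by simp))

/-- Existence of a magic block: the block of `y₀` on `[-n, n]` determines which blocks the
preimages show at its centre, no matter which point of `Y` the block occurs in. It is found by
minimising the number of blocks seen. -/
lemma exists_magic_block [Finite C] [DiscreteTopology C] [DiscreteTopology B] [Nonempty Y.carrier]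
    {φ : Z.carrier → Y.carrier} (hc : Continuous φ)
    (hs : Function.Semiconj φ (shiftMap Z) (shiftMap Y)) (M : ℕ) :
    ∃ (y₀ : Y.carrier) (n : ℕ) (D : Set (Icc (-M : ℤ) M → C)), ∀ (y : Y.carrier) (t : ℤ),
      (∀ j : ℤ, |j| ≤ n → (y : ℤ → B) (t + j) = (y₀ : ℤ → B) j) → fiberWindows φ M t y = D := by
  let c : Y.carrier → ℕ := fun y => (fiberWindows φ M 0 y).ncard
  let y₀ : Y.carrier := Function.argmin c
  obtain ⟨n, hn⟩ := exists_radius_fiberWindows_subset hc M y₀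
  refine ⟨y₀, n, fiberWindows φ M 0 y₀, fun y t h => ?_⟩
  rw [← fiberWindows_translate hs]
  exact eq_of_subset_of_ncard_le (hn _ h) (Function.argmin_le c _) (toFinite _)

lemma IsDoublyTransitive.exists_eqOn {y : Y.carrier} (hy : IsDoublyTransitive y) (y₀ : Y.carrier)
    (a b N : ℤ) :
    (∃ s ≥ N, ∀ j, a ≤ j → j ≤ b → (y : ℤ → B) (s + j) = (y₀ : ℤ → B) j) ∧
      ∃ s ≤ N, ∀ j, a ≤ j → j ≤ b → (y : ℤ → B) (s + j) = (y₀ : ℤ → B) j := by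
  let u : List B := List.ofFn fun k : Fin (b + 1 - a).toNat => (y₀ : ℤ → B) (a + k)
  have hu : u ∈ language Y := ⟨y₀, y₀.2, a, fun k hk => by simp [u]⟩
  have key (i : ℤ) (hi : OccursAt u (y : ℤ → B) i) (j : ℤ) (h1 : a ≤ j) (h2 : j ≤ b) :
      (y : ℤ → B) (i - a + j) = (y₀ : ℤ → B) j := by
    have := hi (j - a).toNat (by simp [u]; omega)
    simp only [u, List.getElem_ofFn, Int.toNat_of_nonneg (sub_nonneg.2 h1)] at this
    convert this using 2 <;> ring
  obtain ⟨⟨i, hi, hui⟩, i', hi', hui'⟩ := hy u hu (N + a)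
  exact ⟨⟨i - a, by omega, key i hui⟩, i' - a, by omega, key i' hui'⟩

lemma encard_fiber_translate_le {π : X.carrier → Y.carrier}
    (hs : Function.Semiconj π (shiftMap X) (shiftMap Y)) (t : ℤ) (y : Y.carrier) :
    (π ⁻¹' {translate Y t y}).encard ≤ (π ⁻¹' {y}).encard := by
  refine encard_le_encard_of_injOn (f := translate X (-t)) (fun x hx => ?_) fun x _ x' _ h => ?_
  · rw [mem_preimage, mem_singleton_iff] at hx ⊢
    rw [(semiconj_translate hs _).eq, hx, translate_translate, add_neg_cancel, translate_zero]
  · have := congrArg (translate X t) h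
    simpa [translate_translate, translate_zero] using this

/-- Distinct points of a finite set of sequences already differ on some block. -/
lemma exists_radius_injOn {S : Set X.carrier} (hS : S.Finite) :
    ∃ K : ℕ, ∀ x ∈ S, ∀ x' ∈ S, (∀ j : ℤ, |j| ≤ K → (x : ℤ → A) j = (x' : ℤ → A) j) →
      x = x' := by
  have hsep (p : X.carrier × X.carrier) : ∃ K : ℕ, p.1 ≠ p.2 →
      ∃ j : ℤ, |j| ≤ K ∧ (p.1 : ℤ → A) j ≠ (p.2 : ℤ → A) j := by
    by_cases h : p.1 = p.2
    · exact ⟨0, fun h' => absurd h h'⟩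
    · obtain ⟨j, hj⟩ := Function.ne_iff.1 (fun h' => h (Subtype.ext h'))
      exact ⟨j.natAbs, fun _ => ⟨j, by simp, hj⟩⟩
  choose k hk using hsep
  obtain ⟨K, hK⟩ := ((hS.prod hS).image k).bddAbove
  refine ⟨K, fun x hx x' hx' h => ?_⟩
  by_contra hne
  obtain ⟨j, hj, hj'⟩ := hk (x, x') hne
  have : k (x, x') ≤ K := hK (mem_image_of_mem k (mk_mem_prod hx hx'))
  exact hj' (h j (hj.trans (by exact_mod_cast this)))

/-- The heart of the existence of the degree. The finitely many preimages of `y` are told apart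
between two occurrences of a magic block; there they can be transplanted, by splicing, into
preimages of any `y'` that shows the same block of `y`. -/
lemma encard_fiber_le_of_isDoublyTransitive [Finite A] [DiscreteTopology A] [DiscreteTopology B]
    (hX : IsSofic X) {π : X.carrier → Y.carrier} (hπ : IsFactorCode π) (hfin : IsFiniteToOne π)
    {y y' : Y.carrier} (hy : IsDoublyTransitive y) (hy' : IsDoublyTransitive y') :
    (π ⁻¹' {y}).encard ≤ (π ⁻¹' {y'}).encard := by
  obtain ⟨k, Z, ρ, hZ, hρ⟩ := hX
  have : Nonempty Y.carrier := ⟨y⟩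
  have hcφ : Continuous (π ∘ ρ) := hπ.continuous.comp hρ.continuous
  have hsφ : Function.Semiconj (π ∘ ρ) (shiftMap Z) (shiftMap Y) :=
    hπ.semiconj.comp_left hρ.semiconj
  obtain ⟨r, hr⟩ := exists_radius_of_semiconj hρ.continuous hρ.semiconj
  obtain ⟨r', hr'⟩ := exists_radius_of_semiconj hcφ hsφ
  obtain ⟨M₀, hM₀⟩ := hZ.exists_splice
  obtain ⟨M, hrM, hr'M, hMM⟩ : ∃ M : ℕ, r ≤ M ∧ r' ≤ M ∧ M₀ ≤ M :=
    ⟨r + r' + M₀, by omega, by omega, by omega⟩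
  have hsplice := hM₀ M hMM
  have locρ (z z' : Z.carrier) (t : ℤ)
      (h : ∀ j, t - M ≤ j → j ≤ t + M → (z : ℤ → Fin (k + 1)) j = (z' : ℤ → Fin (k + 1)) j) :
      (ρ z : ℤ → A) t = (ρ z' : ℤ → A) t :=
    hr z z' t fun j hj => by
      rw [abs_le] at hj
      exact h _ (by omega) (by omega)
  have locφ (z z' : Z.carrier) (t : ℤ)
      (h : ∀ j, t - M ≤ j → j ≤ t + M → (z : ℤ → Fin (k + 1)) j = (z' : ℤ → Fin (k + 1)) j) :
      (π (ρ z) : ℤ → B) t = (π (ρ z') : ℤ → B) t :=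
    hr' z z' t fun j hj => by
      rw [abs_le] at hj
      exact h _ (by omega) (by omega)
  obtain ⟨y₀, n, D, hD⟩ := exists_magic_block hcφ hsφ M
  obtain ⟨K, hK⟩ := exists_radius_injOn (hfin y)
  obtain ⟨t₁, ht₁, hm₁⟩ := (hy.exists_eqOn y₀ (-n) n (-K)).2
  obtain ⟨t₂, ht₂, hm₂⟩ := (hy.exists_eqOn y₀ (-n) n K).1
  obtain ⟨s, -, hs⟩ := (hy'.exists_eqOn y (t₁ - n) (t₂ + n) 0).1
  refine le_trans ?_ (encard_fiber_translate_le hπ.semiconj s y')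
  set y'' := translate Y s y' with hy''
  have hs (j : ℤ) (h1 : t₁ - n ≤ j) (h2 : j ≤ t₂ + n) : (y'' : ℤ → B) j = (y : ℤ → B) j :=
    hs j h1 h2
  have hy₁ : fiberWindows (π ∘ ρ) M t₁ y = D := hD y t₁ fun j hj => by
    rw [abs_le] at hj; exact hm₁ j (by omega) (by omega)
  have hy₂ : fiberWindows (π ∘ ρ) M t₂ y = D := hD y t₂ fun j hj => by
    rw [abs_le] at hj; exact hm₂ j (by omega) (by omega)
  have hy₁'' : fiberWindows (π ∘ ρ) M t₁ y'' = D := hD y'' t₁ fun j hj => by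
    rw [abs_le] at hj
    rw [hs _ (by omega) (by omega)]
    exact hm₁ j (by omega) (by omega)
  have hy₂'' : fiberWindows (π ∘ ρ) M t₂ y'' = D := hD y'' t₂ fun j hj => by
    rw [abs_le] at hj
    rw [hs _ (by omega) (by omega)]
    exact hm₂ j (by omega) (by omega)
  have htrans (x : X.carrier) (hx : π x = y) : ∃ x'' : X.carrier, π x'' = y'' ∧
      ∀ j, t₁ ≤ j → j ≤ t₂ → (x'' : ℤ → A) j = (x : ℤ → A) j := by
    obtain ⟨z, rfl⟩ := hρ.surjective x
    obtain ⟨p₁, hp₁, hw₁⟩ : window M t₁ (z : ℤ → Fin (k + 1)) ∈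
        fiberWindows (π ∘ ρ) M t₁ y'' := by rw [hy₁'', ← hy₁]; exact ⟨z, hx, rfl⟩
    obtain ⟨p₂, hp₂, hw₂⟩ : window M t₂ (z : ℤ → Fin (k + 1)) ∈
        fiberWindows (π ∘ ρ) M t₂ y'' := by rw [hy₂'', ← hy₂]; exact ⟨z, hx, rfl⟩
    obtain ⟨z₁, hl₁, hr₁⟩ := hsplice p₁ z t₁ hw₁
    obtain ⟨z₂, hl₂, hr₂⟩ := hsplice z₁ p₂ t₂ <| by
      rw [show window M t₂ (p₂ : ℤ → Fin (k + 1)) = _ from hw₂, window_eq_iff]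
      intro j hj
      rw [abs_le] at hj
      exact hr₁ _ (by omega)
    have hp₁ : π (ρ p₁) = y'' := hp₁
    have hp₂ : π (ρ p₂) = y'' := hp₂
    refine ⟨ρ z₂, Subtype.ext (funext fun j => ?_), fun j h1 h2 => ?_⟩
    · rcases le_total j t₁ with h1 | h1
      · rw [← hp₁]
        exact locφ _ _ _ fun i _ _ => by rw [hl₂ i (by omega), hl₁ i (by omega)]
      · rcases le_total j t₂ with h2 | h2
        · rw [hs j (by omega) (by omega), ← hx]
          exact locφ _ _ _ fun i _ _ => by rw [hl₂ i (by omega), hr₁ i (by omega)]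
        · rw [← hp₂]
          exact locφ _ _ _ fun i _ _ => hr₂ i (by omega)
    · exact locρ _ _ _ fun i _ _ => by rw [hl₂ i (by omega), hr₁ i (by omega)]
  choose! f hf hfeq using htrans
  refine encard_le_encard_of_injOn (f := f) (fun x hx => hf x hx) fun x hx x' hx' h => ?_
  refine hK x hx x' hx' fun j hj => ?_
  rw [abs_le] at hj
  rw [← hfeq x hx j (by omega) (by omega), h, hfeq x' hx' j (by omega) (by omega)]

theorem isDegree_degree [Finite A] [DiscreteTopology A] [DiscreteTopology B]
    (hX : IsSofic X) {π : X.carrier → Y.carrier} (hπ : IsFactorCode π) (hfin : IsFiniteToOne π) :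
    IsDegree π (degree π) := by
  have hex : ∃ d, IsDegree π d := by
    by_cases h : ∃ y : Y.carrier, IsDoublyTransitive y
    · obtain ⟨y, hy⟩ := h
      refine ⟨(π ⁻¹' {y}).ncard, fun y' hy' => ?_⟩
      rw [(hfin y).cast_ncard_eq]
      exact le_antisymm (encard_fiber_le_of_isDoublyTransitive hX hπ hfin hy' hy)
        (encard_fiber_le_of_isDoublyTransitive hX hπ hfin hy hy')
    -- Without doubly transitive points every number is a degree.
    · exact ⟨0, fun y hy => absurd ⟨y, hy⟩ h⟩
  rw [degree, dif_pos hex]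
  exact hex.choose_spec

end Degree

/-! ### Typical points are doubly transitive -/

section Typical

variable {B : Type*} [TopologicalSpace B] {Y : Subshift B ℤ}

lemma occursAt_translate {u : List B} {t i : ℤ} {y : Y.carrier} :
    OccursAt u (translate Y t y : ℤ → B) i ↔ OccursAt u (y : ℤ → B) (t + i) := by
  simp [OccursAt, add_assoc]

lemma isOpen_setOf_occursAt [DiscreteTopology B] (u : List B) (i : ℤ) :
    IsOpen {y : Y.carrier | OccursAt u (y : ℤ → B) i} := by
  have : {y : Y.carrier | OccursAt u (y : ℤ → B) i} =
      ⋂ k : Fin u.length, {y : Y.carrier | (y : ℤ → B) (i + k) = u[k]} := by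
    ext y
    simp [OccursAt, Fin.forall_iff]
  rw [this]
  exact isOpen_iInter_of_finite fun k =>
    (isOpen_discrete {u[k]}).preimage (continuous_coord (i + k : ℤ))

lemma exists_occursAt_of_mem_language {u : List B} (hu : u ∈ language Y) (i : ℤ) :
    ∃ y : Y.carrier, OccursAt u (y : ℤ → B) i := by
  obtain ⟨x, hx, j, hj⟩ := hu
  refine ⟨translate Y (j - i) ⟨x, hx⟩, ?_⟩
  rw [occursAt_translate, sub_add_cancel]
  exact hj

lemma ae_isDoublyTransitive [Finite B] [DiscreteTopology B] [MeasurableSpace B] [BorelSpace B]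
    {ν : Measure Y.carrier} [IsProbabilityMeasure ν] (hν : Ergodic (shiftMap Y) ν)
    (hfull : ν.IsOpenPosMeasure) : ∀ᵐ y ∂ν, IsDoublyTransitive y := by
  have : BorelSpace Y.carrier := Subtype.borelSpace _
  -- Full support rules out the null alternative of ergodicity for nonempty open sets.
  have full {s : Set Y.carrier} (h : s =ᵐ[ν] (∅ : Set Y.carrier) ∨ s =ᵐ[ν] univ) (ho : IsOpen s)
      (hne : s.Nonempty) : ∀ᵐ y ∂ν, y ∈ s := by
    rcases h with h | h
    · exact absurd (by simpa using measure_congr h) (ho.measure_pos ν hne).ne'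
    · exact Filter.eventuallyEq_univ.1 h
  refine (ae_ball_iff (to_countable _)).2 fun u hu => ae_all_iff.2 fun N => ?_
  have hright : ∀ᵐ y : Y.carrier ∂ν, ∃ i ≥ N, OccursAt u (y : ℤ → B) i := by
    have ho : IsOpen {y : Y.carrier | ∃ i ≥ N, OccursAt u (y : ℤ → B) i} := by
      have : {y : Y.carrier | ∃ i ≥ N, OccursAt u (y : ℤ → B) i} =
          ⋃ i ≥ N, {y : Y.carrier | OccursAt u (y : ℤ → B) i} := by ext; simp
      rw [this]
      exact isOpen_biUnion fun i _ => isOpen_setOf_occursAt u i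
    obtain ⟨y, hy⟩ := exists_occursAt_of_mem_language hu N
    have hs := hν.ae_empty_or_univ_of_preimage_ae_le ho.measurableSet.nullMeasurableSet
    refine full (hs (Filter.Eventually.of_forall ?_)) ho ⟨y, N, le_rfl, hy⟩
    rintro y ⟨i, hi, h⟩
    exact ⟨1 + i, by omega, occursAt_translate.1 h⟩
  have hleft : ∀ᵐ y : Y.carrier ∂ν, ∃ i ≤ N, OccursAt u (y : ℤ → B) i := by
    have ho : IsOpen {y : Y.carrier | ∃ i ≤ N, OccursAt u (y : ℤ → B) i} := by
      have : {y : Y.carrier | ∃ i ≤ N, OccursAt u (y : ℤ → B) i} =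
          ⋃ i ≤ N, {y : Y.carrier | OccursAt u (y : ℤ → B) i} := by ext; simp
      rw [this]
      exact isOpen_biUnion fun i _ => isOpen_setOf_occursAt u i
    obtain ⟨y, hy⟩ := exists_occursAt_of_mem_language hu N
    have hs := hν.ae_empty_or_univ_of_ae_le_preimage ho.measurableSet.nullMeasurableSet
    refine full (hs (Filter.Eventually.of_forall ?_)) ho ⟨y, N, le_rfl, hy⟩
    rintro y ⟨i, hi, h⟩
    refine ⟨i - 1, by omega, occursAt_translate.2 ?_⟩
    rwa [add_sub_cancel]
  exact hright.and hleft

end Typical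

/-! ### Ergodic separating joinings of finite-to-one extensions -/

section Joining

variable {α β : Type*} [MeasurableSpace α] [MeasurableSpace β]

/-- A map `π` between standard Borel spaces all but null many of whose fibers have `d` points
admits a measurable enumeration of these fibers: the tuples that enumerate a fiber increasingly,
for a measurable linear order, form a Borel set on which `π` is injective, and the
Lusin–Souslin theorem provides a measurable inverse. -/
lemma exists_measurable_enumeration [StandardBorelSpace α] [StandardBorelSpace β] {π : α → β}
    (hπ : Measurable π) {ν : Measure β} [IsProbabilityMeasure ν] {d : ℕ} (hd : 0 < d)
    (hfib : ∀ᵐ y ∂ν, (π ⁻¹' {y}).encard = d) :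
    ∃ s : β → Fin d → α, Measurable s ∧
      ∀ᵐ y ∂ν, Function.Injective (s y) ∧ range (s y) = π ⁻¹' {y} := by
  obtain ⟨e, he⟩ := MeasureTheory.exists_measurableEmbedding_real α
  obtain ⟨N, hN, hNm, hN0⟩ := exists_measurable_superset_of_null (ae_iff.1 hfib)
  have hG (y : β) (hy : y ∉ N) : (π ⁻¹' {y}).encard = d := by
    by_contra h
    exact hy (hN h)
  let i₀ : Fin d := ⟨0, hd⟩
  let E : Set (Fin d → α) :=
    {p | StrictMono (e ∘ p) ∧ (∀ i j, π (p i) = π (p j)) ∧ π (p i₀) ∉ N}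
  have hE : MeasurableSet E := by
    have h1 : MeasurableSet {p : Fin d → α | StrictMono (e ∘ p)} := by
      simp only [StrictMono, Function.comp_apply, ofPred_forall]
      exact MeasurableSet.iInter fun i => MeasurableSet.iInter fun j =>
        MeasurableSet.iInter fun _ => measurableSet_lt
          (he.measurable.comp (measurable_pi_apply i)) (he.measurable.comp (measurable_pi_apply j))
    have h2 : MeasurableSet {p : Fin d → α | ∀ i j, π (p i) = π (p j)} := by
      simp only [ofPred_forall]
      exact MeasurableSet.iInter fun i => MeasurableSet.iInter fun j => measurableSet_eq_fun
        (hπ.comp (measurable_pi_apply i)) (hπ.comp (measurable_pi_apply j))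
    have h3 : MeasurableSet {p : Fin d → α | π (p i₀) ∉ N} :=
      (hπ.comp (measurable_pi_apply i₀)) hNm.compl
    exact h1.inter (h2.inter h3)
  -- An element of `E` enumerates the whole fiber it lies in.
  have hrange (p : Fin d → α) (hp : p ∈ E) : range p = π ⁻¹' {π (p i₀)} := by
    have hinj : Function.Injective p := hp.1.injective.of_comp
    have hcard := hG _ hp.2.2
    refine Finite.eq_of_subset_of_encard_le (finite_range p) ?_ ?_
    · rintro _ ⟨i, rfl⟩
      exact hp.2.1 i i₀
    · rw [hcard, ← image_univ, hinj.encard_image]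
      simp
  have := hE.standardBorel
  let q : E → β := fun p => π (p.1 i₀)
  have hq : Measurable q := hπ.comp ((measurable_pi_apply i₀).comp measurable_subtype_coe)
  have hqinj : Function.Injective q := by
    intro p p' h
    have hr : range (e ∘ p.1) = range (e ∘ p'.1) := by
      rw [range_comp, range_comp, hrange _ p.2, hrange _ p'.2]
      exact congrArg (fun y => e '' (π ⁻¹' {y})) h
    have := (p.2.1.range_inj p'.2.1).1 hr
    exact Subtype.ext (funext fun i => he.injective (congrFun this i))
  have hα : Nonempty α := by
    obtain ⟨y, hy⟩ := hfib.exists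
    have : (π ⁻¹' {y}).Nonempty := by
      rw [← encard_pos, hy]
      exact_mod_cast hd
    exact this.to_type
  obtain ⟨s, hs, hsq⟩ := (hq.measurableEmbedding hqinj).exists_measurable_extend
    (measurable_subtype_coe (p := (· ∈ E))) fun _ => inferInstance
  refine ⟨s, hs, ?_⟩
  have hNae : ∀ᵐ y ∂ν, y ∉ N := measure_eq_zero_iff_ae_notMem.1 hN0
  filter_upwards [hNae] with y hy
  obtain ⟨p, hp⟩ : ∃ p : E, q p = y := by
    have hcard := hG y hy
    have hfin := (finite_of_encard_eq_coe hcard).image e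
    have hc : hfin.toFinset.card = d := by
      rw [← ncard_eq_toFinset_card _ hfin, ncard_image_of_injective _ he.injective, ncard, hcard]
      rfl
    have hmem (i : Fin d) : ∃ x, π x = y ∧ e x = hfin.toFinset.orderEmbOfFin hc i := by
      have := Finset.orderEmbOfFin_mem hfin.toFinset hc i
      rwa [Finite.mem_toFinset] at this
    choose p hp hpe using hmem
    refine ⟨⟨p, fun i j hij => ?_, fun i j => by rw [hp, hp], by rwa [hp]⟩, hp _⟩
    simpa [hpe] using hij
  have hsy : s y = p.1 := by rw [← hp]; exact congrFun hsq p
  rw [hsy, hrange _ p.2, ← hp]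
  exact ⟨p.2.1.injective.of_comp, rfl⟩

open Classical in
/-- The number of orderings of the tuple `p` that belong to `W`. -/
noncomputable def orderingCount {d : ℕ} (W : Set (Fin d → α)) (p : Fin d → α) : ℕ :=
  ∑ τ : Equiv.Perm (Fin d), if p ∘ τ ∈ W then 1 else 0

omit [MeasurableSpace α] in
lemma orderingCount_congr {d : ℕ} {W W' : Set (Fin d → α)} {p : Fin d → α}
    (h : ∀ τ : Equiv.Perm (Fin d), p ∘ τ ∈ W ↔ p ∘ τ ∈ W') :
    orderingCount W p = orderingCount W' p := by
  classical
  exact Finset.sum_congr rfl fun τ _ => if_congr (h τ) rfl rfl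

omit [MeasurableSpace α] in
lemma orderingCount_comp_perm {d : ℕ} (W : Set (Fin d → α)) (p : Fin d → α)
    (κ : Equiv.Perm (Fin d)) : orderingCount W (p ∘ κ) = orderingCount W p := by
  classical
  exact Equiv.sum_comp (Equiv.mulLeft κ) fun τ => if p ∘ τ ∈ W then 1 else 0

lemma measurable_orderingCount {d : ℕ} {W : Set (Fin d → α)} (hW : MeasurableSet W) :
    Measurable (orderingCount W) := by
  classical
  refine Finset.measurable_sum _ fun τ _ => Measurable.ite ?_ measurable_const measurable_const
  exact (measurable_pi_lambda _ fun i => measurable_pi_apply (τ i)) hW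

/-- The measure on `d`-tuples obtained by drawing `y` from `ν` and summing the point masses at all
orderings of the tuple `s y`. Its total mass is `d !`. -/
noncomputable def orderingMeasure {d : ℕ} (s : β → Fin d → α) (ν : Measure β) :
    Measure (Fin d → α) :=
  ∑ τ : Equiv.Perm (Fin d), ν.map fun y => s y ∘ τ

variable {d : ℕ} {s : β → Fin d → α} {ν : Measure β}

lemma measurable_comp_perm (hs : Measurable s) (τ : Equiv.Perm (Fin d)) :
    Measurable fun y => s y ∘ τ :=
  measurable_pi_lambda _ fun i => (measurable_pi_apply (τ i)).comp hs

lemma orderingMeasure_apply (hs : Measurable s) {W : Set (Fin d → α)} (hW : MeasurableSet W) :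
    orderingMeasure s ν W = ∫⁻ y, orderingCount W (s y) ∂ν := by
  classical
  simp only [orderingMeasure, orderingCount, Measure.finsetSum_apply, Nat.cast_sum]
  rw [lintegral_finsetSum]
  · refine Finset.sum_congr rfl fun τ _ => ?_
    rw [Measure.map_apply (measurable_comp_perm hs τ) hW,
      ← lintegral_indicator_one (measurable_comp_perm hs τ hW)]
    refine lintegral_congr fun y => ?_
    simp [indicator_apply]
  · intro τ _
    refine Measurable.comp (measurable_from_top (f := ((↑) : ℕ → ENNReal)))
      (Measurable.ite ?_ measurable_const measurable_const)
    exact measurable_comp_perm hs τ hW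

lemma ae_orderingMeasure (hs : Measurable s) {P : (Fin d → α) → Prop}
    (hP : MeasurableSet {p | P p}) (h : ∀ᵐ y ∂ν, ∀ τ : Equiv.Perm (Fin d), P (s y ∘ τ)) :
    ∀ᵐ p ∂orderingMeasure s ν, P p := by
  rw [ae_iff, orderingMeasure, Measure.finsetSum_apply]
  refine Finset.sum_eq_zero fun τ _ => ?_
  refine (Measure.map_apply (measurable_comp_perm hs τ) hP.compl).trans ?_
  exact ae_iff.1 (h.mono fun y hy => hy τ)

/-- Over an ergodic base with fibers of constant finite size, an invariant set of fiber
enumerations meets almost all fibers in equally many points; the symmetric measure on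
enumerations, restricted to an invariant set for which this number is minimal, is ergodic. -/
theorem exists_ergodic_separating_joining [StandardBorelSpace α] [StandardBorelSpace β]
    {T : α → α} {S : β → β} {π : α → β} (hT : Measurable T) (hTinj : Function.Injective T)
    (hπ : Measurable π) (hsemi : Function.Semiconj π T S) [IsProbabilityMeasure ν]
    (hν : Ergodic S ν) (hd : 0 < d) (hfib : ∀ᵐ y ∂ν, (π ⁻¹' {y}).encard = d) :
    ∃ lam : Measure (Fin d → α), IsRelativeJoining T π lam ∧ LiesOver π lam ν ∧
      Ergodic (diagMap T d) lam ∧ IsSeparating lam := by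
  obtain ⟨s, hs, hsfib⟩ := exists_measurable_enumeration hπ hd hfib
  have hdiag : Measurable (diagMap T d) :=
    measurable_pi_lambda _ fun i => hT.comp (measurable_pi_apply i)
  set Lam := orderingMeasure s ν with hLam
  -- The diagonal map carries the enumerations of the fiber of `y` onto those of `S y`.
  have hcount : ∀ᵐ y ∂ν, ∀ W : Set (Fin d → α),
      orderingCount (diagMap T d ⁻¹' W) (s y) = orderingCount W (s (S y)) := by
    filter_upwards [hsfib, hν.quasiMeasurePreserving.ae hsfib] with y hy hSy W
    have hmem (i : Fin d) : ∃ j, s (S y) j = T (s y i) := by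
      have h : T (s y i) ∈ π ⁻¹' {S y} := by
        have : s y i ∈ π ⁻¹' {y} := hy.2 ▸ mem_range_self i
        rw [mem_preimage, mem_singleton_iff] at this ⊢
        rw [hsemi.eq, this]
      rwa [← hSy.2] at h
    choose κ hκ using hmem
    have hκinj : Function.Injective κ := fun i j hij => by
      refine hy.1 (hTinj ?_)
      rw [← hκ, ← hκ, hij]
    let κ' : Equiv.Perm (Fin d) := Equiv.ofBijective κ (Finite.injective_iff_bijective.1 hκinj)
    rw [← orderingCount_comp_perm W _ κ']
    have h : s (S y) ∘ κ' = diagMap T d (s y) := funext hκ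
    rw [h]
    rfl
  have hconst {W : Set (Fin d → α)} (hW : MeasurableSet W) (hinv : diagMap T d ⁻¹' W = W) :
      ∃ c : ℕ, ∀ᵐ y ∂ν, orderingCount W (s y) = c := by
    refine hν.quasiErgodic.ae_eq_const_of_ae_eq_comp₀ (g := fun y => orderingCount W (s y))
      ((measurable_orderingCount hW).comp hs).nullMeasurable ?_
    filter_upwards [hcount] with y hy
    rw [Function.comp_apply, ← hy W, hinv]
  have hLamconst {W : Set (Fin d → α)} (hW : MeasurableSet W) {c : ℕ}
      (hc : ∀ᵐ y ∂ν, orderingCount W (s y) = c) : Lam W = c := by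
    rw [hLam, orderingMeasure_apply hs hW, lintegral_congr_ae (g := fun _ => (c : ENNReal))]
    · simp
    · filter_upwards [hc] with y hy
      rw [hy]
  obtain ⟨c, ⟨hcpos, W, hW, hinv, hc⟩, hmin⟩ : ∃ c : ℕ, (0 < c ∧ ∃ W : Set (Fin d → α),
      MeasurableSet W ∧ diagMap T d ⁻¹' W = W ∧ ∀ᵐ y ∂ν, orderingCount W (s y) = c) ∧
      ∀ m < c, ¬ (0 < m ∧ ∃ W : Set (Fin d → α),
        MeasurableSet W ∧ diagMap T d ⁻¹' W = W ∧ ∀ᵐ y ∂ν, orderingCount W (s y) = m) := by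
    classical
    have hex : ∃ c : ℕ, 0 < c ∧ ∃ W : Set (Fin d → α), MeasurableSet W ∧
        diagMap T d ⁻¹' W = W ∧ ∀ᵐ y ∂ν, orderingCount W (s y) = c :=
      ⟨Fintype.card (Equiv.Perm (Fin d)), Fintype.card_pos, univ, MeasurableSet.univ, rfl,
        Filter.Eventually.of_forall fun y => by simp [orderingCount]⟩
    exact ⟨Nat.find hex, Nat.find_spec hex, fun m => Nat.find_min hex⟩
  have hc0 : (c : ENNReal) ≠ 0 := by exact_mod_cast hcpos.ne'
  have hctop : (c : ENNReal) ≠ ⊤ := ENNReal.natCast_ne_top c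
  have hLaminv : MeasurePreserving (diagMap T d) Lam Lam := by
    refine ⟨hdiag, Measure.ext fun V hV => ?_⟩
    rw [Measure.map_apply hdiag hV, hLam, orderingMeasure_apply hs (hdiag hV),
      orderingMeasure_apply hs hV]
    rw [lintegral_congr_ae (g := fun y => (orderingCount V (s (S y)) : ENNReal))]
    · exact hν.toMeasurePreserving.lintegral_comp (f := fun y => (orderingCount V (s y) : ENNReal))
        ((measurable_from_top (f := ((↑) : ℕ → ENNReal))).comp
          ((measurable_orderingCount hV).comp hs))
    · filter_upwards [hcount] with y hy
      rw [hy]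
  set lam : Measure (Fin d → α) := (c : ENNReal)⁻¹ • Lam.restrict W with hlam
  have hlam_apply {V : Set (Fin d → α)} (hV : MeasurableSet V) :
      lam V = (c : ENNReal)⁻¹ * Lam (V ∩ W) := by
    rw [hlam, Measure.smul_apply, Measure.restrict_apply hV, smul_eq_mul]
  have hlam_inv : MeasurePreserving (diagMap T d) lam lam := by
    have := hLaminv.restrict_preimage hW
    rw [hinv] at this
    exact this.smul_measure _
  have hlam_ae {P : (Fin d → α) → Prop} (h : ∀ᵐ p ∂Lam, P p) : ∀ᵐ p ∂lam, P p :=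
    Measure.ae_smul_measure (ae_restrict_of_ae h) _
  have hfiber (i : Fin d) : ∀ᵐ y ∂ν, ∀ τ : Equiv.Perm (Fin d), π ((s y ∘ τ) i) = y := by
    filter_upwards [hsfib] with y hy τ
    have : s y (τ i) ∈ π ⁻¹' {y} := hy.2 ▸ mem_range_self _
    exact this
  refine ⟨lam, ⟨⟨?_⟩, hlam_inv, hlam_ae ?_⟩, ⟨⟨0, hd⟩, ?_⟩, ⟨hlam_inv, ⟨fun V hV hVinv => ?_⟩⟩,
    hlam_ae ?_⟩
  · rw [hlam_apply MeasurableSet.univ, univ_inter, hLamconst hW hc,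
      ENNReal.inv_mul_cancel hc0 hctop]
  · refine ae_orderingMeasure hs ?_ ?_
    · simp only [ofPred_forall]
      exact MeasurableSet.iInter fun i => MeasurableSet.iInter fun j => measurableSet_eq_fun
        (hπ.comp (measurable_pi_apply i)) (hπ.comp (measurable_pi_apply j))
    · filter_upwards [ae_all_iff.2 hfiber] with y hy τ i j
      rw [hy i τ, hy j τ]
  · ext U hU
    have hU' : MeasurableSet {p : Fin d → α | π (p ⟨0, hd⟩) ∈ U} :=
      (hπ.comp (measurable_pi_apply _)) hU
    rw [Measure.map_apply hπ hU, Measure.map_apply (measurable_pi_apply _) (hπ hU)]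
    change lam {p : Fin d → α | π (p ⟨0, hd⟩) ∈ U} = ν U
    rw [hlam_apply hU', hLam, orderingMeasure_apply hs (hU'.inter hW),
      lintegral_congr_ae (g := U.indicator fun _ => (c : ENNReal)), lintegral_indicator hU,
      setLIntegral_const, ← mul_assoc, ENNReal.inv_mul_cancel hc0 hctop, one_mul]
    filter_upwards [hc, hfiber ⟨0, hd⟩] with y hy hfy
    by_cases hyU : y ∈ U
    · rw [indicator_of_mem hyU, ← hy]
      have hmem (τ : Equiv.Perm (Fin d)) :
          s y ∘ τ ∈ {p | π (p ⟨0, hd⟩) ∈ U} ∩ W ↔ s y ∘ τ ∈ W := by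
        rw [mem_inter_iff, mem_ofPred_eq, hfy, and_iff_right hyU]
      rw [orderingCount_congr hmem]
    · rw [indicator_of_notMem hyU]
      simp only [orderingCount, mem_inter_iff, mem_ofPred_eq, hfy, hyU, false_and, if_false,
        Finset.sum_const_zero, Nat.cast_zero]
  · have hV₁ : diagMap T d ⁻¹' (V ∩ W) = V ∩ W := by rw [preimage_inter, hVinv, hinv]
    have hV₂ : diagMap T d ⁻¹' (Vᶜ ∩ W) = Vᶜ ∩ W := by
      rw [preimage_inter, preimage_compl, hVinv, hinv]
    obtain ⟨c₁, hc₁⟩ := hconst (hV.inter hW) hV₁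
    obtain ⟨c₂, hc₂⟩ := hconst (hV.compl.inter hW) hV₂
    have hsum : c₁ + c₂ = c := by
      have h : Lam (V ∩ W) + Lam (Vᶜ ∩ W) = Lam W := by
        rw [inter_comm V, inter_comm Vᶜ, ← Set.sdiff_eq]
        exact measure_inter_add_sdiff W hV
      rw [hLamconst (hV.inter hW) hc₁, hLamconst (hV.compl.inter hW) hc₂, hLamconst hW hc] at h
      exact_mod_cast h
    rw [Filter.eventuallyConst_set']
    -- By minimality of `c = c₁ + c₂`, one of the two invariant parts of `W` is null.
    by_cases h : c₁ = 0
    · left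
      rw [ae_eq_empty, hlam_apply hV, hLamconst (hV.inter hW) hc₁, h]
      simp
    · right
      have h₂ : c₂ = 0 := by
        by_contra h₂
        exact hmin c₁ (by omega) ⟨by omega, _, hV.inter hW, hV₁, hc₁⟩
      rw [ae_eq_univ, hlam_apply hV.compl, hLamconst (hV.compl.inter hW) hc₂, h₂]
      simp
  · refine ae_orderingMeasure hs ?_ ?_
    · have : {p : Fin d → α | Function.Injective p} = ⋂ (i) (j) (_ : i ≠ j), {p | p i = p j}ᶜ := by
        ext p
        simp only [Function.Injective, mem_ofPred_eq, mem_iInter, mem_compl_iff]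
        exact forall₂_congr fun i j => not_imp_not.symm
      rw [this]
      exact MeasurableSet.iInter fun i => MeasurableSet.iInter fun j => MeasurableSet.iInter fun _ =>
        (measurableSet_eq_fun (measurable_pi_apply i) (measurable_pi_apply j)).compl
    · filter_upwards [hsfib] with y hy τ
      exact hy.1.comp τ.injective

end Joining

end SoficCode

theorem mainTheorem2
    {A B : Type*} [Finite A] [TopologicalSpace A] [DiscreteTopology A]
    [MeasurableSpace A] [BorelSpace A]
    [Finite B] [TopologicalSpace B] [DiscreteTopology B] [MeasurableSpace B] [BorelSpace B]
    (X : SymbolicDynamics.FullShift.Subshift A ℤ) (Y : SymbolicDynamics.FullShift.Subshift B ℤ)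
    (hXirr : SoficCode.IsIrreducible X) (hXsofic : SoficCode.IsSofic X)
    (π : X.carrier → Y.carrier) (hπ : SoficCode.IsFactorCode π)
    (hfin : SoficCode.IsFiniteToOne π)
    (ν : MeasureTheory.Measure Y.carrier) [MeasureTheory.IsProbabilityMeasure ν]
    (hνerg : Ergodic (SoficCode.shiftMap Y) ν) (hνfull : ν.IsOpenPosMeasure) :
    ∃ lam : MeasureTheory.Measure (Fin (SoficCode.degree π) → X.carrier),
      SoficCode.IsRelativeJoining (SoficCode.shiftMap X) π lam ∧
      SoficCode.LiesOver π lam ν ∧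
      Ergodic (SoficCode.diagMap (SoficCode.shiftMap X) (SoficCode.degree π)) lam ∧
      SoficCode.IsSeparating lam := by
  have hBX : BorelSpace X.carrier := Subtype.borelSpace _
  have hBY : BorelSpace Y.carrier := Subtype.borelSpace _
  have := X.isClosed.measurableSet.standardBorel
  have := Y.isClosed.measurableSet.standardBorel
  have hdt := SoficCode.ae_isDoublyTransitive hνerg hνfull
  have hdeg := SoficCode.isDegree_degree hXsofic hπ hfin
  have hfib : ∀ᵐ y ∂ν, (π ⁻¹' {y}).encard = SoficCode.degree π := hdt.mono fun y hy => hdeg y hy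
  have hpos : 0 < SoficCode.degree π := by
    obtain ⟨y, hy⟩ := hfib.exists
    obtain ⟨x, hx⟩ := hπ.surjective y
    have : 0 < (π ⁻¹' {y}).encard := Set.encard_pos.2 ⟨x, hx⟩
    rw [hy] at this
    exact_mod_cast this
  refine SoficCode.exists_ergodic_separating_joining ?_ ?_ hπ.continuous.measurable hπ.semiconj
    hνerg hpos hfib
  · exact (((SymbolicDynamics.FullShift.continuous_shift 1).comp
      continuous_subtype_val).subtype_mk _).measurable
  · intro x x' h
    have := congrArg (SoficCode.translate X (-1)) h
    simpa [← SoficCode.translate_one, SoficCode.translate_translate, SoficCode.translate_zero]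
      using this
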